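/- Let $M$ be a smooth manifold of dimension $n\ge 3$, and let $L:TM\to\mathbb R$ be a Finsler structure on $M$: $L$ is $C^\infty$ and positive on the bundle $\mathcal TM$ of nonzero tangent vectors, positively homogeneous of degree $1$ on the fibres, and the Finsler metric $g_u(v,w)=\tfrac12\,\partial_s\partial_t\,L(u+sv+tw)^2\big|_{s=t=0}$ on the pullback bundle $\pi^{-1}(TM)\to\mathcal TM$ ($\pi:\mathcal TM\to M$) is positive definite. Let $\rho=d\pi:T(\mathcal TM)\to\pi^{-1}(TM)$, let $\gamma:\pi^{-1}(TM)\to T(\mathcal TM)$ be the vertical lift, and $\bar\eta(u)=(u,u)$. A connection $\nabla$ on $\pi^{-1}(TM)$ is regular if $T_u(\mathcal TM)=\ker\rho_u\oplus\{X:\nabla_X\bar\eta=0\}$ for all $u$; then $\beta$ denotes the inverse of $\rho$ restricted to the horizontal space $\{X:\nabla_X\bar\eta=0\}$. Its torsion is $\mathbf T(X,Y)=\nabla_X\rho Y-\nabla_Y\rho X-\rho[X,Y]$ and its curvature is $\mathbf K(X,Y)\bar Z=-\nabla_X\nabla_Y\bar Z+\nabla_Y\nabla_X\bar Z+\nabla_{[X,Y]}\bar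 Z$. Let $\nabla$ be the Cartan connection of $(M,L)$, i.e. the regular connection with $\nabla g=0$, $\mathbf T(\beta\bar X,\beta\bar Y)=0$, and $g(T(\bar X,\bar Y),\bar Z)=g(T(\bar X,\bar Z),\bar Y)$, where $T(\bar X,\bar Y)=\mathbf T(\gamma\bar X,\beta\bar Y)$. Let $R(\bar X,\bar Y)\bar Z=\mathbf K(\beta\bar X,\beta\bar Y)\bar Z$ be its horizontal curvature tensor, $Ric(\bar X,\bar Z)=\operatorname{Tr}\{\bar Y\mapsto R(\bar X,\bar Y)\bar Z\}$, $r=\operatorname{Tr}_g Ric$ the horizontal scalar curvature, and $G(\bar X,\bar Y)\bar Z=g(\bar X,\bar Z)\bar Y-g(\bar Y,\bar Z)\bar X$. Call $(M,L)$ concircularly flat if the concircular curvature tensor $C=R-\frac{r}{n(n-1)}\,G$ vanishes, and h-isotropic if $R=k_0G$ for some scalar function $k_0$, i.e. some $C^\infty$ function on $\mathcal TM$ (which may be zero). Then: 1. $(M,L)$ is concircularly flat if and only if it is h-isotropic. 2. If $R=k_0G$ for a function $k_0:\mathcal TM\to\mathbb R$, then $k_0=\frac{r}{n(n-1)}$.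 3. $(M,L)$ is concircularly flat with $R\neq0$ if and only if $R=k_0G$ for some scalar function $k_0$ that is not identically zero. -/

import Mathlib

open Bundle Manifold ContDiff

namespace PullbackFinsler

noncomputable section

variable (E : Type*) [NormedAddCommGroup E] [NormedSpace ℝ E]
  (M : Type*) [TopologicalSpace M] [ChartedSpace E M] [IsManifold 𝓘(ℝ, E) ∞ M]

/-! ### The slit tangent bundle and the pullback bundle -/

/-- The tangent bundle `TM` of a smooth manifold `M` modelled on `E`. -/
abbrev TM : Type _ := TangentBundle 𝓘(ℝ, E) M

/-- The projection `π : TM → M`, as a smooth map. -/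
abbrev proj : C^∞⟮𝓘(ℝ, E).tangent, TM E M; 𝓘(ℝ, E), M⟯ :=
  ⟨TotalSpace.proj, Bundle.contMDiff_proj _⟩

/-- The set of nonzero tangent vectors. It is open in `TM`, so the geometry of the slit tangent
bundle is the geometry of `TM` on this set. -/
def slit : Set (TM E M) := {u | u.2 ≠ 0}

/-- The pullback bundle `π⁻¹(TM)` over `TM`: its fibre over `u` is the tangent space of `M` at
`π u`. -/
abbrev PB : TM E M → Type _ := (proj E M) *ᵖ (TangentSpace 𝓘(ℝ, E) : M → Type _)

instance instAddCommGroupPB (u : TM E M) : AddCommGroup (PB E M u) :=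
  inferInstanceAs (AddCommGroup (TangentSpace 𝓘(ℝ, E) (proj E M u)))

instance instIsTopologicalAddGroupPB (u : TM E M) : IsTopologicalAddGroup (PB E M u) :=
  inferInstanceAs (IsTopologicalAddGroup (TangentSpace 𝓘(ℝ, E) (proj E M u)))

instance instContinuousSMulPB (u : TM E M) : ContinuousSMul ℝ (PB E M u) :=
  inferInstanceAs (ContinuousSMul ℝ (TangentSpace 𝓘(ℝ, E) (proj E M u)))

instance instFiniteDimensionalPB [h : FiniteDimensional ℝ E] (u : TM E M) :
    FiniteDimensional ℝ (PB E M u) := h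

/-- (Not necessarily smooth) `π`-vector fields. -/
abbrev PiField : Type _ := Π u : TM E M, PB E M u

/-- (Not necessarily smooth) vector fields on `TM`. -/
abbrev VField : Type _ := Π u : TM E M, TangentSpace 𝓘(ℝ, E).tangent u

variable {E M}

/-- The `π`-vector field `X` is `C^∞` on `U`. -/
def PiField.SmoothOn (X : PiField E M) (U : Set (TM E M)) : Prop :=
  ContMDiffOn 𝓘(ℝ, E).tangent (𝓘(ℝ, E).tangent.prod 𝓘(ℝ, E)) ∞
    (fun u ↦ (⟨u, X u⟩ : TotalSpace E (PB E M))) U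

/-- Scalar functions: real functions that are `C^∞` on the slit tangent bundle. -/
def IsScalarFunction (k : TM E M → ℝ) : Prop :=
  ContMDiffOn 𝓘(ℝ, E).tangent 𝓘(ℝ, ℝ) ∞ k (slit E M)

variable (E M) in
/-- The fundamental `π`-vector field `η(u) = (u, u)`. -/
def eta : PiField E M := fun u ↦ u.2

/-- The bundle morphism `ρ : T(TM) → π⁻¹(TM)`, i.e. the differential of `π`. -/
def rho (u : TM E M) : TangentSpace 𝓘(ℝ, E).tangent u →L[ℝ] PB E M u :=
  mfderiv 𝓘(ℝ, E).tangent 𝓘(ℝ, E) (proj E M) u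

/-- The tangent vector `u + v`, for `v` in the tangent space in which `u` lies. -/
def translate (u : TM E M) (v : PB E M u) : TM E M := ⟨u.proj, eta E M u + v⟩

/-- The bundle morphism `γ : π⁻¹(TM) → T(TM)`, the vertical lift: `γ v` is the velocity at `t = 0`
of the curve `t ↦ u + t v`. -/
def gamma (u : TM E M) (v : PB E M u) : TangentSpace 𝓘(ℝ, E).tangent u :=
  mfderiv 𝓘(ℝ, ℝ) 𝓘(ℝ, E).tangent (fun t : ℝ ↦ translate u (t • v)) 0 (1 : ℝ)

/-! ### Finsler structures -/

/-- The bilinear form `½ ∂²L²/∂y²` at `u`, i.e.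
`g_u(v, w) = ½ ∂²/∂s∂t L(u + s v + t w)²` at `s = t = 0`. -/
def fundamentalForm (L : TM E M → ℝ) (u : TM E M) (v w : PB E M u) : ℝ :=
  (1 / 2) * deriv (fun s : ℝ ↦ deriv (fun t : ℝ ↦ L (translate u (s • v + t • w)) ^ 2) 0) 0

variable (E M) in
/-- A Finsler structure `L` on `M`: a function on `TM`, smooth and positive on nonzero vectors,
positively homogeneous of degree one (so that it vanishes on the zero section), whose fundamental
form is positive definite. -/
structure FinslerStructure where
  L : TM E M → ℝ
  smooth : ContMDiffOn 𝓘(ℝ, E).tangent 𝓘(ℝ, ℝ) ∞ L (slit E M)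
  pos : ∀ u ∈ slit E M, 0 < L u
  homogeneous : ∀ (x : M) (y : TangentSpace 𝓘(ℝ, E) x) (c : ℝ), 0 < c →
    L ⟨x, c • y⟩ = c * L ⟨x, y⟩
  posDef : ∀ u ∈ slit E M, ∀ v : PB E M u, v ≠ 0 → 0 < fundamentalForm L u v v

/-- The Finsler metric `g` on `π⁻¹(TM)` defined by `L`. -/
def FinslerStructure.g (F : FinslerStructure E M) (u : TM E M) (v w : PB E M u) : ℝ :=
  fundamentalForm F.L u v w

/-! ### Regular connections on the pullback bundle -/

/-- The connection map `K : T(TM) → π⁻¹(TM)`, `K X = D_X η`, of an operator `D` on `π`-vector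
fields (`D Z u X` stands for `D_X Z` at `u`). -/
def connectionMap (D : PiField E M → Π u : TM E M, TangentSpace 𝓘(ℝ, E).tangent u →L[ℝ] PB E M u)
    (u : TM E M) : TangentSpace 𝓘(ℝ, E).tangent u →L[ℝ] PB E M u :=
  D (eta E M) u

variable (E M) in
/-- A regular (smooth, linear) connection on the pullback bundle over the slit tangent bundle:
the tangent space at every nonzero `u` is the direct sum of the vertical space `ker ρ` and of the
horizontal space `ker K`. `D Z u X` stands for `D_X Z` at `u`; values at zero vectors `u` are
irrelevant. -/
structure RegularConnection where
  D : PiField E M → Π u : TM E M, TangentSpace 𝓘(ℝ, E).tangent u →L[ℝ] PB E M u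
  isCovariantDerivativeOn : IsCovariantDerivativeOn E D (slit E M)
  smooth : ∀ U : Set (TM E M), IsOpen U → U ⊆ slit E M →
    ContMDiffCovariantDerivativeOn E ∞ D U
  regular : ∀ u ∈ slit E M,
    IsCompl (LinearMap.ker (rho u).toLinearMap) (LinearMap.ker (connectionMap D u).toLinearMap)

variable (nabla : RegularConnection E M)

open Classical in
/-- The horizontal map `β`, the inverse of the restriction of `ρ` to the horizontal space:
for nonzero `u`, `β v` is the unique horizontal vector `X` at `u` with `ρ X = v`
(see `existsUnique_horizontal`). -/
def RegularConnection.beta (u : TM E M) (v : PB E M u) : TangentSpace 𝓘(ℝ, E).tangent u :=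
  if h : ∃ X : TangentSpace 𝓘(ℝ, E).tangent u, connectionMap nabla.D u X = 0 ∧ rho u X = v
  then h.choose else 0

theorem rho_surjective [FiniteDimensional ℝ E] (u : TM E M) : Function.Surjective (rho u) := by
  let s : M → TM E M := fun x ↦
    ⟨x, FiberBundle.extend E (u.2 : TangentSpace 𝓘(ℝ, E) u.proj) x⟩
  have hs : MDifferentiableAt 𝓘(ℝ, E) 𝓘(ℝ, E).tangent s u.proj :=
    FiberBundle.mdifferentiableAt_extend 𝓘(ℝ, E) E u.2
  have hsu : s u.proj = u := by simp [s]
  have hp : MDifferentiableAt 𝓘(ℝ, E).tangent 𝓘(ℝ, E) (proj E M) (s u.proj) :=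
    (proj E M).contMDiff.mdifferentiable (by simp) _
  have hcomp := hp.hasMFDerivAt.comp u.proj hs.hasMFDerivAt
  have hid : HasMFDerivAt 𝓘(ℝ, E) 𝓘(ℝ, E) ((proj E M) ∘ s) u.proj
      (ContinuousLinearMap.id ℝ (TangentSpace 𝓘(ℝ, E) u.proj)) := hasMFDerivAt_id u.proj
  have heq := hasMFDerivAt_unique hcomp hid
  have key : Function.Surjective (rho (s u.proj)) := fun v ↦
    ⟨mfderiv 𝓘(ℝ, E) 𝓘(ℝ, E).tangent s u.proj v, DFunLike.congr_fun heq v⟩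
  rwa [hsu] at key

/-- Horizontal lifts exist and are unique at nonzero vectors. -/
theorem RegularConnection.existsUnique_horizontal [FiniteDimensional ℝ E] {u : TM E M}
    (hu : u ∈ slit E M) (v : PB E M u) :
    ∃! X : TangentSpace 𝓘(ℝ, E).tangent u, connectionMap nabla.D u X = 0 ∧ rho u X = v := by
  obtain ⟨X, rfl⟩ := rho_surjective u v
  have hreg := nabla.regular u hu
  obtain ⟨a, ha, b, hb, rfl⟩ := Submodule.mem_sup.1
    (hreg.sup_eq_top ▸ Submodule.mem_top : X ∈ LinearMap.ker (rho u).toLinearMap ⊔ _)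
  have ha' : rho u a = 0 := ha
  have hb' : connectionMap nabla.D u b = 0 := hb
  refine ⟨b, ⟨hb', by rw [map_add, ha', zero_add]⟩, fun c hc ↦ ?_⟩
  have h1 : c - b ∈ LinearMap.ker (rho u).toLinearMap := by
    change rho u (c - b) = 0
    rw [map_sub, hc.2, map_add, ha', zero_add, sub_self]
  have h2 : c - b ∈ LinearMap.ker (connectionMap nabla.D u).toLinearMap := by
    change connectionMap nabla.D u (c - b) = 0
    rw [map_sub, hc.1, hb', sub_self]
  exact sub_eq_zero.1 (Submodule.disjoint_def.1 hreg.disjoint _ h1 h2)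

/-- The classical torsion `T(X, Y) = D_X ρY - D_Y ρX - ρ[X, Y]` of the connection. -/
def RegularConnection.torsion (X Y : VField E M) : PiField E M := fun u ↦
  nabla.D (fun w ↦ rho w (Y w)) u (X u) - nabla.D (fun w ↦ rho w (X w)) u (Y u)
    - rho u (VectorField.mlieBracket 𝓘(ℝ, E).tangent X Y u)

/-- The classical curvature `K(X, Y)Z` of the connection, with the sign convention
`K(X, Y)Z = -D_X D_Y Z + D_Y D_X Z + D_[X, Y] Z`. -/
def RegularConnection.curvature (X Y : VField E M) (Z : PiField E M) : PiField E M := fun u ↦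
  -nabla.D (fun w ↦ nabla.D Z w (Y w)) u (X u) + nabla.D (fun w ↦ nabla.D Z w (X w)) u (Y u)
    + nabla.D Z u (VectorField.mlieBracket 𝓘(ℝ, E).tangent X Y u)

/-- The (h)h-torsion `Q(X, Y) = T(βX, βY)`. -/
def RegularConnection.hhTorsion (X Y : PiField E M) : PiField E M :=
  nabla.torsion (fun u ↦ nabla.beta u (X u)) (fun u ↦ nabla.beta u (Y u))

/-- The (h)hv-torsion `T(X, Y) = T(γX, βY)`. -/
def RegularConnection.hhvTorsion (X Y : PiField E M) : PiField E M :=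
  nabla.torsion (fun u ↦ gamma u (X u)) (fun u ↦ nabla.beta u (Y u))

/-- The horizontal curvature `R(X, Y)Z = K(βX, βY)Z`. -/
def RegularConnection.hCurvature (X Y Z : PiField E M) : PiField E M :=
  nabla.curvature (fun u ↦ nabla.beta u (X u)) (fun u ↦ nabla.beta u (Y u)) Z

/-- The Cartan connection of a Finsler structure: the regular connection that is metric, has
vanishing (h)h-torsion, and whose (h)hv-torsion satisfies `g(T(X, Y), Z) = g(T(X, Z), Y)`. -/
structure IsCartanConnection (F : FinslerStructure E M) (nabla : RegularConnection E M) :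
    Prop where
  metric : ∀ U : Set (TM E M), IsOpen U → U ⊆ slit E M → ∀ Y Z : PiField E M,
    Y.SmoothOn U → Z.SmoothOn U → ∀ u ∈ U, ∀ X : TangentSpace 𝓘(ℝ, E).tangent u,
      mvfderiv 𝓘(ℝ, E).tangent (fun w ↦ F.g w (Y w) (Z w)) u X
        = F.g u (nabla.D Y u X) (Z u) + F.g u (Y u) (nabla.D Z u X)
  hhTorsion_eq_zero : ∀ U : Set (TM E M), IsOpen U → U ⊆ slit E M → ∀ X Y : PiField E M,
    X.SmoothOn U → Y.SmoothOn U → ∀ u ∈ U, nabla.hhTorsion X Y u = 0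
  hhvTorsion_symm : ∀ U : Set (TM E M), IsOpen U → U ⊆ slit E M → ∀ X Y Z : PiField E M,
    X.SmoothOn U → Y.SmoothOn U → Z.SmoothOn U → ∀ u ∈ U,
      F.g u (nabla.hhvTorsion X Y u) (Z u) = F.g u (nabla.hhvTorsion X Z u) (Y u)

/-! ### `π`-tensor fields of type (1,3), Ricci tensor, scalar curvature -/

/-- Two vector valued trilinear `π`-tensor fields, given by their action on `π`-vector fields,
are equal: they agree on all `π`-vector fields that are defined and smooth on an open subset of
the slit tangent bundle. -/
def TensorEq (A B : PiField E M → PiField E M → PiField E M → PiField E M) : Prop :=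
  ∀ U : Set (TM E M), IsOpen U → U ⊆ slit E M → ∀ X Y Z : PiField E M,
    X.SmoothOn U → Y.SmoothOn U → Z.SmoothOn U → ∀ u ∈ U, A X Y Z u = B X Y Z u

/-- The value `R_u(x, y)z` of the horizontal curvature on vectors of the fibre over `u`. Since `R`
is a tensor, any extension of the vectors to `π`-vector fields smooth near `u` may be used. -/
def RegularConnection.hCurvatureAt (u : TM E M) (x y z : PB E M u) : PB E M u :=
  nabla.hCurvature (FiberBundle.extend E x) (FiberBundle.extend E y) (FiberBundle.extend E z) u

/-- The horizontal Ricci tensor `Ric(x, z)`, the trace of `y ↦ R(x, y)z`, computed in a basis of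
the fibre. -/
def RegularConnection.ricci [FiniteDimensional ℝ E] (u : TM E M) (x z : PB E M u) : ℝ :=
  ∑ i, (Module.finBasis ℝ (PB E M u)).repr
    (nabla.hCurvatureAt u x (Module.finBasis ℝ (PB E M u) i) z) i

/-- The matrix of the Finsler metric `g` in a basis of the fibre over `u`. -/
def FinslerStructure.gram [FiniteDimensional ℝ E] (F : FinslerStructure E M) (u : TM E M) :
    Matrix (Fin (Module.finrank ℝ (PB E M u))) (Fin (Module.finrank ℝ (PB E M u))) ℝ :=
  Matrix.of fun i j ↦ F.g u (Module.finBasis ℝ (PB E M u) i) (Module.finBasis ℝ (PB E M u) j)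

/-- The horizontal scalar curvature `r`, the trace of `Ric` with respect to `g`. -/
def scalarCurvature [FiniteDimensional ℝ E] (F : FinslerStructure E M)
    (nabla : RegularConnection E M) (u : TM E M) : ℝ :=
  ∑ i, ∑ j, (F.gram u)⁻¹ i j *
    nabla.ricci u (Module.finBasis ℝ (PB E M u) i) (Module.finBasis ℝ (PB E M u) j)

/-- The `π`-tensor field `G(X, Y)Z = g(X, Z)Y - g(Y, Z)X`. -/
def FinslerStructure.G (F : FinslerStructure E M) (X Y Z : PiField E M) : PiField E M := fun u ↦
  F.g u (X u) (Z u) • Y u - F.g u (Y u) (Z u) • X u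

/-- The concircular curvature tensor `C = R - r / (n (n - 1)) G`, where `n = dim M`. -/
def concircularCurvature [FiniteDimensional ℝ E] (F : FinslerStructure E M)
    (nabla : RegularConnection E M) (X Y Z : PiField E M) : PiField E M := fun u ↦
  nabla.hCurvature X Y Z u
    - (scalarCurvature F nabla u / ((Module.finrank ℝ E : ℝ) * ((Module.finrank ℝ E : ℝ) - 1))) •
      F.G X Y Z u

/-- `(M, L)` with Cartan connection `nabla` is concircularly flat: `C = 0`. -/
def IsConcircularlyFlat [FiniteDimensional ℝ E] (F : FinslerStructure E M)
    (nabla : RegularConnection E M) : Prop :=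
  TensorEq (concircularCurvature F nabla) (fun _ _ _ _ ↦ 0)

/-- The horizontal curvature has the form `R = k G`. -/
def HasHCurvature (F : FinslerStructure E M) (nabla : RegularConnection E M) (k : TM E M → ℝ) :
    Prop :=
  TensorEq nabla.hCurvature (fun X Y Z u ↦ k u • F.G X Y Z u)

/-- `(M, L)` with Cartan connection `nabla` is h-isotropic: `R = k G` for a scalar function `k`. -/
def IsHIsotropic (F : FinslerStructure E M) (nabla : RegularConnection E M) : Prop :=
  ∃ k : TM E M → ℝ, IsScalarFunction k ∧ HasHCurvature F nabla k

end

end PullbackFinsler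

namespace PullbackFinsler

noncomputable section

variable {E : Type*} [NormedAddCommGroup E] [NormedSpace ℝ E]
  {M : Type*} [TopologicalSpace M] [ChartedSpace E M] [IsManifold 𝓘(ℝ, E) ∞ M]

/-! ### The fundamental form at a point -/

/-! Two traces determine the factor: if `R = k G`, then contracting `y ↦ R(x, y)z` gives `Ric = k (n
- 1) g`, and contracting with the inverse metric gives `r = k n (n - 1)`. Hence `k = r / (n (n -
1))` at every nonzero vector (`HasHCurvature.eq_scalarCurvature_div`). Concircular flatness says
exactly that `R = k G` with this particular `k`, so all that separates it from h-isotropy is the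
smoothness of `k`.

Smoothness cannot be read off the definition of `r`, which uses an arbitrary basis and pointwise
extensions in each fibre. It is recovered from the tensor equation
(`HasHCurvature.isScalarFunction`). By Euler's theorem, `R(η, Y)η = k (L² Y - g(Y, η) η)`; taking a
2 × 2 determinant against `η` removes the last term and leaves `k` as a quotient of smooth
functions. The numerator is smooth because `R` maps smooth fields to smooth fields
(`RegularConnection.smoothOn_hCurvature`), which rests on the smoothness of the horizontal lift `β`
(`RegularConnection.smoothOn_beta`).

Nontriviality in the third claim follows from uniqueness of the factor: `R = 0` means that the
factor `0` also works. -/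

theorem contMDiff_mk_fibre (x : M) :
    ContMDiff 𝓘(ℝ, E) 𝓘(ℝ, E).tangent ∞ (fun v : E ↦ (⟨x, v⟩ : TM E M)) := by
  intro v
  refine contMDiffAt_totalSpace.2 ⟨contMDiffAt_const, ?_⟩
  have h : (fun w : E ↦ (trivializationAt E (TangentSpace 𝓘(ℝ, E)) x (⟨x, w⟩ : TM E M)).2)
      = (trivializationAt E (TangentSpace 𝓘(ℝ, E)) x).continuousLinearMapAt ℝ x := by
    ext w
    exact ((trivializationAt E (TangentSpace 𝓘(ℝ, E)) x).continuousLinearMapAt_apply_of_mem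
      ℝ (FiberBundle.mem_baseSet_trivializationAt' x) w).symm
  exact (show ContMDiffAt 𝓘(ℝ, E) 𝓘(ℝ, E) ∞ _ v from h ▸
    ContinuousLinearMap.contMDiffAt (E := E) (F := E) (n := ∞)
      ((trivializationAt E (TangentSpace 𝓘(ℝ, E)) x).continuousLinearMapAt ℝ x))

/-- Local trivializations are linear on fibres, so being nonzero can be tested on the continuous
fibre coordinate. -/
theorem isOpen_slit : IsOpen (slit E M) := by
  refine isOpen_iff_mem_nhds.2 fun u hu ↦ ?_
  set e := trivializationAt E (TangentSpace 𝓘(ℝ, E)) u.proj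
  have hmem : u.proj ∈ e.baseSet := FiberBundle.mem_baseSet_trivializationAt' u.proj
  have hlin : ∀ w : TM E M, w.proj ∈ e.baseSet → ((e w).2 = 0 ↔ w.2 = 0) := by
    intro w hw
    have h := (e.continuousLinearEquivAt ℝ w.proj hw).map_eq_zero_iff (x := w.2)
    exact h
  have hcont : ContinuousAt (fun w : TM E M ↦ (e w).2) u :=
    continuous_snd.continuousAt.comp (e.continuousAt (e.mem_source.2 hmem))
  have hne : (e u).2 ≠ 0 := fun h ↦ hu ((hlin u hmem).1 h)
  filter_upwards [hcont.eventually_ne hne,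
    (FiberBundle.continuous_proj E (TangentSpace 𝓘(ℝ, E) : M → Type _)).continuousAt.eventually
      (e.open_baseSet.mem_nhds hmem)] with w hw hwb hw0
  exact hw ((hlin w hwb).2 hw0)

/-- The energy `v ↦ L(u + v)²` on the model space. -/
def FinslerStructure.energy (F : FinslerStructure E M) (u : TM E M) (v : E) : ℝ :=
  F.L (translate u v) ^ 2

theorem FinslerStructure.contDiffAt_energy (F : FinslerStructure E M) {u : TM E M}
    (hu : u ∈ slit E M) : ContDiffAt ℝ ∞ (F.energy u) 0 := by
  rw [← contMDiffAt_iff_contDiffAt]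
  have h0 : translate u (0 : E) = u := by
    obtain ⟨x, y⟩ := u
    exact congrArg (TotalSpace.mk x) (add_zero y)
  have h1 : ContMDiffAt 𝓘(ℝ, E).tangent 𝓘(ℝ, ℝ) ∞ F.L (translate u (0 : E)) := by
    rw [h0]
    exact F.smooth.contMDiffAt (isOpen_slit.mem_nhds hu)
  have h2 : ContMDiffAt 𝓘(ℝ, E) 𝓘(ℝ, E).tangent ∞ (fun v : E ↦ translate u v) 0 :=
    (contMDiff_mk_fibre u.proj).contMDiffAt.comp (0 : E)
      (f := fun v : E ↦ (show E from u.2) + v)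
      (contMDiffAt_iff_contDiffAt.2 (contDiffAt_const.add contDiffAt_id))
  exact (h1.comp (0 : E) h2).pow 2

theorem two_le_infty : (2 : WithTop ℕ∞) ≤ ∞ :=
  WithTop.coe_le_coe.2 (le_top : (2 : ℕ∞) ≤ ⊤)

/-- Identifies the iterated derivative defining `g` with a Hessian; bilinearity and symmetry of `g`
then come for free. -/
theorem fderiv_fderiv_eq_deriv_deriv {f : E → ℝ} (hf : ContDiffAt ℝ 2 f 0) (v w : E) :
    deriv (fun s : ℝ ↦ deriv (fun t : ℝ ↦ f (s • v + t • w)) 0) 0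
      = fderiv ℝ (fderiv ℝ f) 0 v w := by
  have hd : ∀ᶠ x in nhds (0 : E), DifferentiableAt ℝ f x :=
    (hf.eventually (by simp)).mono fun x hx ↦ hx.differentiableAt (by simp)
  have hline : HasDerivAt (fun s : ℝ ↦ s • v) v 0 := by
    simpa using (hasDerivAt_id (0 : ℝ)).smul_const v
  have hc : Filter.Tendsto (fun s : ℝ ↦ s • v) (nhds 0) (nhds 0) := by
    simpa using hline.continuousAt.tendsto
  have h1 : (fun s : ℝ ↦ deriv (fun t : ℝ ↦ f (s • v + t • w)) 0)
      =ᶠ[nhds 0] fun s ↦ fderiv ℝ f (s • v) w := by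
    filter_upwards [hc.eventually hd] with s hs
    have hl : HasDerivAt (fun t : ℝ ↦ s • v + t • w) w 0 := by
      simpa using ((hasDerivAt_id (0 : ℝ)).smul_const w).const_add (s • v)
    have hs' : HasFDerivAt f (fderiv ℝ f (s • v)) (s • v + (0 : ℝ) • w) := by
      simpa using hs.hasFDerivAt
    exact (hs'.comp_hasDerivAt 0 hl).deriv
  rw [h1.deriv_eq]
  have hdd : DifferentiableAt ℝ (fderiv ℝ f) 0 :=
    (hf.fderiv_right (m := 1) (by norm_num)).differentiableAt (by simp)
  have hdd' : HasFDerivAt (fderiv ℝ f) (fderiv ℝ (fderiv ℝ f) 0) ((0 : ℝ) • v) := by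
    simpa using hdd.hasFDerivAt
  have h2 : HasDerivAt (fun s : ℝ ↦ fderiv ℝ f (s • v)) (fderiv ℝ (fderiv ℝ f) 0 v) 0 :=
    hdd'.comp_hasDerivAt 0 hline
  have h3 := h2.clm_apply (hasDerivAt_const 0 w)
  simpa using h3.deriv

/-- The Finsler metric at a nonzero vector, as a bilinear form on the model space. -/
def FinslerStructure.metricForm (F : FinslerStructure E M) (u : TM E M) : E →L[ℝ] E →L[ℝ] ℝ :=
  (1 / 2 : ℝ) • fderiv ℝ (fderiv ℝ (F.energy u)) 0

theorem FinslerStructure.g_eq (F : FinslerStructure E M) {u : TM E M} (hu : u ∈ slit E M)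
    (v w : PB E M u) : F.g u v w = F.metricForm u v w := by
  have h := fderiv_fderiv_eq_deriv_deriv
    ((F.contDiffAt_energy hu).of_le two_le_infty) (v : E) (w : E)
  exact congrArg (fun c : ℝ ↦ (1 / 2) * c) h

theorem FinslerStructure.g_symm (F : FinslerStructure E M) {u : TM E M} (hu : u ∈ slit E M)
    (v w : PB E M u) : F.g u v w = F.g u w v := by
  rw [F.g_eq hu, F.g_eq hu]
  have h := (F.contDiffAt_energy hu).isSymmSndFDerivAt
    (by simp only [minSmoothness_of_isRCLikeNormedField]; exact two_le_infty)
  exact congrArg (fun c : ℝ ↦ (1 / 2 : ℝ) • c) (h (v : E) (w : E))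

/-- The Finsler metric at a nonzero vector, as a bilinear form on the fibre. -/
def FinslerStructure.gBilin (F : FinslerStructure E M) (u : TM E M) :
    PB E M u →ₗ[ℝ] PB E M u →ₗ[ℝ] ℝ :=
  LinearMap.mk₂ ℝ (fun v w ↦ F.metricForm u v w)
    (fun v v' w ↦ congrArg (fun A : E →L[ℝ] ℝ ↦ A w) ((F.metricForm u).map_add v v'))
    (fun c v w ↦ congrArg (fun A : E →L[ℝ] ℝ ↦ A w) ((F.metricForm u).map_smul c v))
    (fun v w w' ↦ (F.metricForm u v).map_add w w')
    (fun c v w ↦ (F.metricForm u v).map_smul c w)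

theorem FinslerStructure.gBilin_apply (F : FinslerStructure E M) {u : TM E M}
    (hu : u ∈ slit E M) (v w : PB E M u) : F.gBilin u v w = F.g u v w :=
  (F.g_eq hu v w).symm

/-- Euler's theorem: `g(η, η) = L²`. -/
theorem FinslerStructure.g_eta_eta (F : FinslerStructure E M) (u : TM E M) :
    F.g u (eta E M u) (eta E M u) = F.L u ^ 2 := by
  -- The bound keeps the factor `1 + c` positive, as homogeneity requires; near `0` the energy along
  -- the ray is thus an explicit quadratic.
  have key : ∀ c : ℝ, -1 < c → F.L (translate u (c • eta E M u)) = (1 + c) * F.L u := by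
    intro c hc
    rw [← F.homogeneous u.proj u.2 (1 + c) (by linarith)]
    congr 1
    exact congrArg (TotalSpace.mk u.proj)
      (show eta E M u + c • eta E M u = (1 + c) • eta E M u by module)
  have inner : ∀ s : ℝ, -1 < s → deriv (fun t : ℝ ↦
      F.L (translate u (s • eta E M u + t • eta E M u)) ^ 2) 0 = 2 * (1 + s) * F.L u ^ 2 := by
    intro s hs
    have h : (fun t : ℝ ↦ F.L (translate u (s • eta E M u + t • eta E M u)) ^ 2)
        =ᶠ[nhds 0] fun t ↦ (1 + (s + t)) ^ 2 * F.L u ^ 2 := by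
      filter_upwards [Ioi_mem_nhds (show -1 - s < 0 by linarith)] with t ht
      rw [← add_smul, key _ (by simp only [Set.mem_Ioi] at ht; linarith), mul_pow]
    rw [h.deriv_eq]
    have hd : HasDerivAt (fun t : ℝ ↦ (1 + (s + t)) ^ 2 * F.L u ^ 2)
        (2 * (1 + s) * F.L u ^ 2) 0 := by
      have := ((((hasDerivAt_id (0 : ℝ)).const_add s).const_add 1).pow 2).mul_const (F.L u ^ 2)
      simpa using this
    exact hd.deriv
  have outer : (fun s : ℝ ↦ deriv (fun t : ℝ ↦
      F.L (translate u (s • eta E M u + t • eta E M u)) ^ 2) 0)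
      =ᶠ[nhds 0] fun s ↦ 2 * (1 + s) * F.L u ^ 2 := by
    filter_upwards [Ioi_mem_nhds (show (-1 : ℝ) < 0 by norm_num)] with s hs using inner s hs
  have hd : HasDerivAt (fun s : ℝ ↦ 2 * (1 + s) * F.L u ^ 2) (2 * F.L u ^ 2) 0 := by
    have := (((hasDerivAt_id (0 : ℝ)).const_add 1).const_mul 2).mul_const (F.L u ^ 2)
    simpa using this
  simp only [FinslerStructure.g, fundamentalForm]
  rw [outer.deriv_eq, hd.deriv]
  ring

/-! ### The scalar curvature when `R = k G` -/

/-- The map `y ↦ B x z • y` has trace `n * B x z`, and the rank-one map `y ↦ B y z • x` has trace `B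
x z`. -/
theorem sum_repr_curvature {V ι : Type*} [AddCommGroup V] [Module ℝ V] [Fintype ι]
    (b : Module.Basis ι ℝ V) (B : V →ₗ[ℝ] V →ₗ[ℝ] ℝ) (c : ℝ) (x z : V) :
    ∑ i, b.repr (c • (B x z • b i - B (b i) z • x)) i
      = c * ((Fintype.card ι : ℝ) - 1) * B x z := by
  have htr : ∑ i, b.repr x i * B (b i) z = B x z := by
    conv_rhs => rw [← b.sum_repr x]
    simp only [map_sum B, map_smul B, LinearMap.sum_apply, LinearMap.smul_apply, smul_eq_mul]
  have hterm : ∀ i, b.repr (c • (B x z • b i - B (b i) z • x)) i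
      = c * (B x z - b.repr x i * B (b i) z) := by
    intro i
    simp [mul_comm (B (b i) z)]
  rw [Finset.sum_congr rfl fun i _ ↦ hterm i, ← Finset.mul_sum, Finset.sum_sub_distrib, htr]
  simp only [Finset.sum_const, Finset.card_univ, nsmul_eq_mul]
  ring

/-- A kernel vector `c` gives `v = ∑ c j • b j` orthogonal to every basis vector, so `B v v = 0` and
`v = 0`. -/
theorem isUnit_of_posDef_gram {V ι : Type*} [AddCommGroup V] [Module ℝ V] [Fintype ι]
    [DecidableEq ι] (b : Module.Basis ι ℝ V) (B : V →ₗ[ℝ] V →ₗ[ℝ] ℝ)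
    (hB : ∀ v, v ≠ 0 → 0 < B v v) : IsUnit (Matrix.of fun i j ↦ B (b i) (b j)) := by
  rw [← Matrix.mulVec_injective_iff_isUnit, ← Matrix.coe_mulVecLin, ← LinearMap.ker_eq_bot,
    LinearMap.ker_eq_bot']
  intro c hc
  have hi : ∀ i, B (b i) (∑ j, c j • b j) = 0 := by
    intro i
    have := congrFun hc i
    simpa [Matrix.mulVec, dotProduct, mul_comm] using this
  have h0 : ∑ i, c i • b i = 0 := by
    by_contra hne
    refine (hB _ hne).ne' ?_
    simp only [map_sum (B), map_smul B, LinearMap.sum_apply, LinearMap.smul_apply, hi, smul_zero,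
      Finset.sum_const_zero]
  exact funext (Fintype.linearIndependent_iff.1 b.linearIndependent c h0)

/-- An extension has constant coordinates in the trivialization at `u`, so a single `U` serves all
vectors `x`, as `TensorEq` demands. -/
theorem exists_isOpen_smoothOn_extend {u : TM E M} (hu : u ∈ slit E M) :
    ∃ U : Set (TM E M), IsOpen U ∧ U ⊆ slit E M ∧ u ∈ U ∧
      ∀ x : PB E M u, PiField.SmoothOn (FiberBundle.extend E x) U := by
  set t := trivializationAt E (PB E M) u
  refine ⟨slit E M ∩ t.baseSet, isOpen_slit.inter t.open_baseSet, Set.inter_subset_left,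
    ⟨hu, FiberBundle.mem_baseSet_trivializationAt' u⟩, fun x ↦ ?_⟩
  intro w hw
  rw [t.contMDiffWithinAt_section _ hw.2]
  refine (contMDiffWithinAt_const (c := (t ⟨u, x⟩).2)).congr_of_eventuallyEq_of_mem ?_ hw
  filter_upwards [self_mem_nhdsWithin] with v hv
  have h := congrArg Prod.snd (t.apply_mk_symm hv.2 (t ⟨u, x⟩).2)
  exact h

section

variable {F : FinslerStructure E M} {nabla : RegularConnection E M}
  {k : TM E M → ℝ}

theorem HasHCurvature.hCurvatureAt_eq (h : HasHCurvature F nabla k) {u : TM E M}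
    (hu : u ∈ slit E M) (x y z : PB E M u) :
    nabla.hCurvatureAt u x y z = k u • (F.g u x z • y - F.g u y z • x) := by
  obtain ⟨U, hU, hUs, huU, hext⟩ := exists_isOpen_smoothOn_extend hu
  have := h U hU hUs _ _ _ (hext x) (hext y) (hext z) u huU
  simp only [FinslerStructure.G, FiberBundle.extend_apply_self] at this
  exact this

theorem HasHCurvature.congr {k' : TM E M → ℝ} (h : HasHCurvature F nabla k)
    (hk : ∀ u ∈ slit E M, k u = k' u) : HasHCurvature F nabla k' := by
  intro U hU hUs X Y Z hX hY hZ u hu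
  exact (h U hU hUs X Y Z hX hY hZ u hu).trans (by simp only [hk u (hUs hu)])

variable [FiniteDimensional ℝ E]

theorem HasHCurvature.ricci_eq (h : HasHCurvature F nabla k) {u : TM E M}
    (hu : u ∈ slit E M) (x z : PB E M u) :
    nabla.ricci u x z = k u * ((Module.finrank ℝ E : ℝ) - 1) * F.g u x z := by
  have h1 := sum_repr_curvature (Module.finBasis ℝ (PB E M u)) (F.gBilin u) (k u) x z
  simp_rw [F.gBilin_apply hu, Fintype.card_fin, ← h.hCurvatureAt_eq hu] at h1
  exact h1

theorem FinslerStructure.isUnit_gram (F : FinslerStructure E M) {u : TM E M}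
    (hu : u ∈ slit E M) : IsUnit (F.gram u) := by
  have h := isUnit_of_posDef_gram (Module.finBasis ℝ (PB E M u)) (F.gBilin u)
    fun v hv ↦ (F.posDef u hu v hv).trans_eq (F.gBilin_apply hu v v).symm
  simp_rw [F.gBilin_apply hu] at h
  exact h

theorem HasHCurvature.scalarCurvature_eq (h : HasHCurvature F nabla k) {u : TM E M}
    (hu : u ∈ slit E M) :
    scalarCurvature F nabla u
      = k u * ((Module.finrank ℝ E : ℝ) * ((Module.finrank ℝ E : ℝ) - 1)) := by
  have hinv : (F.gram u)⁻¹ * F.gram u = 1 :=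
    Matrix.nonsing_inv_mul _ ((Matrix.isUnit_iff_isUnit_det _).1 (F.isUnit_gram hu))
  have hfin : Module.finrank ℝ (PB E M u) = Module.finrank ℝ E := rfl
  have htr := congrArg Matrix.trace hinv
  simp only [Matrix.trace, Matrix.diag, Matrix.mul_apply, Matrix.one_apply_eq,
    Finset.sum_const, Finset.card_univ, Fintype.card_fin, nsmul_eq_mul, mul_one, hfin] at htr
  have hterm : ∀ i j, (F.gram u)⁻¹ i j *
      nabla.ricci u (Module.finBasis ℝ (PB E M u) i) (Module.finBasis ℝ (PB E M u) j)
      = k u * ((Module.finrank ℝ E : ℝ) - 1) * ((F.gram u)⁻¹ i j * F.gram u j i) := by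
    intro i j
    -- Swapping the arguments of `g` turns the double sum into the trace of `gram⁻¹ * gram`, which
    -- is `n`.
    rw [h.ricci_eq hu, F.g_symm hu]
    simp only [FinslerStructure.gram, Matrix.of_apply]
    ring
  simp_rw [scalarCurvature, hterm, ← Finset.mul_sum]
  rw [htr]
  ring

theorem HasHCurvature.eq_scalarCurvature_div (h : HasHCurvature F nabla k)
    (hn : 2 ≤ Module.finrank ℝ E) {u : TM E M} (hu : u ∈ slit E M) :
    k u = scalarCurvature F nabla u
      / ((Module.finrank ℝ E : ℝ) * ((Module.finrank ℝ E : ℝ) - 1)) := by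
  have hn' : (2 : ℝ) ≤ Module.finrank ℝ E := by exact_mod_cast hn
  rw [h.scalarCurvature_eq hu, mul_div_assoc, div_self, mul_one]
  exact (mul_pos (by linarith) (by linarith)).ne'

theorem isConcircularlyFlat_iff_hasHCurvature :
    IsConcircularlyFlat F nabla ↔ HasHCurvature F nabla fun u ↦ scalarCurvature F nabla u
      / ((Module.finrank ℝ E : ℝ) * ((Module.finrank ℝ E : ℝ) - 1)) := by
  refine forall_congr' fun U ↦ forall_congr' fun _ ↦ forall_congr' fun _ ↦ forall_congr' fun X ↦
    forall_congr' fun Y ↦ forall_congr' fun Z ↦ forall_congr' fun _ ↦ forall_congr' fun _ ↦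
    forall_congr' fun _ ↦ forall_congr' fun u ↦ forall_congr' fun _ ↦ ?_
  exact sub_eq_zero

end

/-! ### Smoothness of the horizontal map and of the horizontal curvature -/

/-- The vector field `X` on `TM` is `C^∞` on `U`. -/
def VField.SmoothOn (X : VField E M) (U : Set (TM E M)) : Prop :=
  ContMDiffOn 𝓘(ℝ, E).tangent (𝓘(ℝ, E).tangent.prod 𝓘(ℝ, E × E)) ∞
    (fun u ↦ (⟨u, X u⟩ : TotalSpace (E × E) (TangentSpace 𝓘(ℝ, E).tangent : TM E M → Type _))) U

/-- The coordinates of `η` at `w` are the fibre coordinates of the point `w` itself, so this is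
smoothness of the identity of `TM`. -/
theorem smoothOn_eta (U : Set (TM E M)) : (eta E M).SmoothOn U := by
  intro u _
  refine ContMDiffAt.contMDiffWithinAt ((contMDiffAt_section u).2 ?_)
  exact (contMDiffAt_totalSpace.1 (contMDiffAt_id (I := 𝓘(ℝ, E).tangent) (x := u))).2

open ContinuousLinearMap (inCoordinates)

theorem inCoordinates_apply_trivializationAt {B F₁ F₂ : Type*} [TopologicalSpace B]
    [NormedAddCommGroup F₁] [NormedSpace ℝ F₁] [NormedAddCommGroup F₂] [NormedSpace ℝ F₂]
    {V₁ V₂ : B → Type*} [∀ b, AddCommGroup (V₁ b)] [∀ b, Module ℝ (V₁ b)]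
    [∀ b, TopologicalSpace (V₁ b)] [TopologicalSpace (TotalSpace F₁ V₁)] [FiberBundle F₁ V₁]
    [VectorBundle ℝ F₁ V₁] [∀ b, AddCommGroup (V₂ b)] [∀ b, Module ℝ (V₂ b)]
    [∀ b, TopologicalSpace (V₂ b)] [TopologicalSpace (TotalSpace F₂ V₂)] [FiberBundle F₂ V₂]
    [VectorBundle ℝ F₂ V₂] {b₀ b : B} (hb₁ : b ∈ (trivializationAt F₁ V₁ b₀).baseSet)
    (hb₂ : b ∈ (trivializationAt F₂ V₂ b₀).baseSet) (φ : V₁ b →L[ℝ] V₂ b) (v : V₁ b) :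
    inCoordinates F₁ V₁ F₂ V₂ b₀ b b₀ b φ (trivializationAt F₁ V₁ b₀ ⟨b, v⟩).2
      = (trivializationAt F₂ V₂ b₀ ⟨b, φ v⟩).2 := by
  rw [ContinuousLinearMap.inCoordinates_eq hb₁ hb₂]
  simp [hb₁]

theorem trivialization_snd_eq_zero_iff {B F : Type*} [TopologicalSpace B]
    [NormedAddCommGroup F] [NormedSpace ℝ F]
    {V : B → Type*} [∀ b, AddCommGroup (V b)] [∀ b, Module ℝ (V b)]
    [∀ b, TopologicalSpace (V b)] [TopologicalSpace (TotalSpace F V)] [FiberBundle F V]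
    [VectorBundle ℝ F V] (e : Trivialization F (TotalSpace.proj : TotalSpace F V → B))
    [MemTrivializationAtlas e] {b : B} (hb : b ∈ e.baseSet) (v : V b) :
    (e ⟨b, v⟩).2 = 0 ↔ v = 0 :=
  (e.continuousLinearEquivAt ℝ b hb).map_eq_zero_iff (x := v)

theorem contMDiffAt_rho (u : TM E M) :
    ContMDiffAt 𝓘(ℝ, E).tangent 𝓘(ℝ, E × E →L[ℝ] E) ∞
      (fun w ↦ inCoordinates (E × E) (TangentSpace 𝓘(ℝ, E).tangent : TM E M → Type _)
        E (PB E M) u w u w (rho w)) u := by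
  have h : ContMDiffAt 𝓘(ℝ, E).tangent 𝓘(ℝ, E) ∞ (proj E M) u := (proj E M).contMDiff u
  exact h.mfderiv_const (m := ∞) le_rfl

variable (nabla : RegularConnection E M)

theorem RegularConnection.contMDiffOn_D {U : Set (TM E M)} (hU : IsOpen U) (hUs : U ⊆ slit E M)
    {Z : PiField E M} (hZ : Z.SmoothOn U) :
    ContMDiffOn 𝓘(ℝ, E).tangent (𝓘(ℝ, E).tangent.prod 𝓘(ℝ, E × E →L[ℝ] E)) ∞
      (fun u ↦ (⟨u, nabla.D Z u⟩ : TotalSpace (E × E →L[ℝ] E)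
        fun u : TM E M ↦ TangentSpace 𝓘(ℝ, E).tangent u →L[ℝ] PB E M u)) U :=
  (nabla.smooth U hU hUs).contMDiff hZ

theorem RegularConnection.smoothOn_D {U : Set (TM E M)} (hU : IsOpen U) (hUs : U ⊆ slit E M)
    {Z : PiField E M} (hZ : Z.SmoothOn U) {X : VField E M} (hX : X.SmoothOn U) :
    PiField.SmoothOn (fun u ↦ nabla.D Z u (X u)) U :=
  (nabla.contMDiffOn_D hU hUs hZ).clm_bundle_apply hX

theorem RegularConnection.contMDiffAt_connectionMap {u : TM E M} (hu : u ∈ slit E M) :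
    ContMDiffAt 𝓘(ℝ, E).tangent 𝓘(ℝ, E × E →L[ℝ] E) ∞
      (fun w ↦ inCoordinates (E × E) (TangentSpace 𝓘(ℝ, E).tangent : TM E M → Type _)
        E (PB E M) u w u w (connectionMap nabla.D w)) u :=
  (contMDiffAt_hom_bundle _).1 ((nabla.contMDiffOn_D isOpen_slit subset_rfl
    (smoothOn_eta _)).contMDiffAt (isOpen_slit.mem_nhds hu)) |>.2

/-- The pair `(ρ, K)` of the differential of the projection and the connection map, read in the
trivializations at `u`. -/
def RegularConnection.splitting (u w : TM E M) : E × E →L[ℝ] E × E :=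
  (inCoordinates (E × E) (TangentSpace 𝓘(ℝ, E).tangent : TM E M → Type _)
        E (PB E M) u w u w (rho w)).prod
  (inCoordinates (E × E) (TangentSpace 𝓘(ℝ, E).tangent : TM E M → Type _)
        E (PB E M) u w u w (connectionMap nabla.D w))

theorem RegularConnection.contMDiffAt_splitting {u : TM E M} (hu : u ∈ slit E M) :
    ContMDiffAt 𝓘(ℝ, E).tangent 𝓘(ℝ, E × E →L[ℝ] E × E) ∞ (nabla.splitting u) u :=
  (ContinuousLinearMap.prodₗᵢ ℝ : ((E × E →L[ℝ] E) × (E × E →L[ℝ] E)) ≃ₗᵢ[ℝ]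
    (E × E →L[ℝ] E × E)).toContinuousLinearEquiv.contDiff.contMDiff.contMDiffAt.comp u
    ((contMDiffAt_rho u).prodMk_space (nabla.contMDiffAt_connectionMap hu))

theorem RegularConnection.splitting_apply {u w : TM E M}
    (hw : w ∈ (trivializationAt (E × E) (TangentSpace 𝓘(ℝ, E).tangent : TM E M → Type _) u).baseSet)
    (hw' : w ∈ (trivializationAt E (PB E M) u).baseSet) (X : TangentSpace 𝓘(ℝ, E).tangent w) :
    nabla.splitting u w
      (trivializationAt (E × E) (TangentSpace 𝓘(ℝ, E).tangent : TM E M → Type _) u ⟨w, X⟩).2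
      = ((trivializationAt E (PB E M) u ⟨w, rho w X⟩).2,
        (trivializationAt E (PB E M) u ⟨w, connectionMap nabla.D w X⟩).2) := by
  exact Prod.ext (inCoordinates_apply_trivializationAt hw hw' (rho w) X)
    (inCoordinates_apply_trivializationAt hw hw' (connectionMap nabla.D w) X)

section

variable [FiniteDimensional ℝ E]

/-- Regularity makes `ker ρ` and `ker K` meet trivially, so `(ρ, K)` is injective, hence invertible
in finite dimension. -/
theorem RegularConnection.exists_splitting_eq {u w : TM E M} (hws : w ∈ slit E M)
    (hw : w ∈ (trivializationAt (E × E) (TangentSpace 𝓘(ℝ, E).tangent : TM E M → Type _) u).baseSet)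
    (hw' : w ∈ (trivializationAt E (PB E M) u).baseSet) :
    ∃ e : (E × E) ≃L[ℝ] (E × E), (e : E × E →L[ℝ] E × E) = nabla.splitting u w := by
  have hinj : Function.Injective (nabla.splitting u w) := by
    refine (injective_iff_map_eq_zero _).2 fun c hc ↦ ?_
    set e := trivializationAt (E × E) (TangentSpace 𝓘(ℝ, E).tangent : TM E M → Type _) u
    obtain ⟨X, rfl⟩ := (e.continuousLinearEquivAt ℝ w hw).surjective c
    have h : (_, _) = (0 : E × E) := (nabla.splitting_apply hw hw' X).symm.trans hc
    have h1 : rho w X = 0 := (trivialization_snd_eq_zero_iff _ hw' _).1 (congrArg Prod.fst h)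
    have h2 : connectionMap nabla.D w X = 0 :=
      (trivialization_snd_eq_zero_iff _ hw' _).1 (congrArg Prod.snd h)
    rw [Submodule.disjoint_def.1 (nabla.regular w hws).disjoint X h1 h2, map_zero]
  exact ⟨(LinearEquiv.ofInjectiveEndo (nabla.splitting u w).toLinearMap
    hinj).toContinuousLinearEquiv, by ext <;> rfl⟩

theorem RegularConnection.beta_spec {u : TM E M} (hu : u ∈ slit E M) (v : PB E M u) :
    connectionMap nabla.D u (nabla.beta u v) = 0 ∧ rho u (nabla.beta u v) = v := by
  have h := (nabla.existsUnique_horizontal hu v).exists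
  rw [RegularConnection.beta, dif_pos h]
  exact h.choose_spec

/-- In coordinates `β X` is the preimage of `(X, 0)` under the splitting `(ρ, K)`, and inversion of
operators is smooth at an invertible one. -/
theorem RegularConnection.smoothOn_beta {U : Set (TM E M)} (hU : IsOpen U) (hUs : U ⊆ slit E M)
    {X : PiField E M} (hX : X.SmoothOn U) :
    VField.SmoothOn (fun u ↦ nabla.beta u (X u)) U := by
  intro u hu
  refine ContMDiffAt.contMDiffWithinAt ((contMDiffAt_section u).2 ?_)
  set e := trivializationAt (E × E) (TangentSpace 𝓘(ℝ, E).tangent : TM E M → Type _) u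
  set e' := trivializationAt E (PB E M) u
  have hmem : u ∈ e.baseSet := FiberBundle.mem_baseSet_trivializationAt' u
  have hmem' : u ∈ e'.baseSet := FiberBundle.mem_baseSet_trivializationAt' u
  obtain ⟨A, hA⟩ := nabla.exists_splitting_eq (hUs hu) hmem hmem'
  have hinv : ContMDiffAt 𝓘(ℝ, E).tangent 𝓘(ℝ, E × E →L[ℝ] E × E) ∞
      (fun w ↦ (nabla.splitting u w).inverse) u := by
    have : CompleteSpace E := FiniteDimensional.complete ℝ E
    have h := contDiffAt_map_inverse (n := ∞) A
    rw [hA] at h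
    exact h.contMDiffAt.comp u (nabla.contMDiffAt_splitting (hUs hu))
  have hXu : ContMDiffAt 𝓘(ℝ, E).tangent 𝓘(ℝ, E) ∞ (fun w ↦ (e' ⟨w, X w⟩).2) u :=
    (contMDiffAt_section u).1 (hX.contMDiffAt (hU.mem_nhds hu))
  refine (hinv.clm_apply (hXu.prodMk_space
    (contMDiffAt_const (c := (0 : E))))).congr_of_eventuallyEq ?_
  filter_upwards [hU.mem_nhds hu, e.open_baseSet.mem_nhds hmem, e'.open_baseSet.mem_nhds hmem']
    with w hwU hw hw'
  obtain ⟨B, hB⟩ := nabla.exists_splitting_eq (u := u) (hUs hwU) hw hw'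
  have hspec := nabla.beta_spec (hUs hwU) (X w)
  have happ := nabla.splitting_apply hw hw' (nabla.beta w (X w))
  rw [hspec.1, hspec.2, (trivialization_snd_eq_zero_iff e' hw' 0).2 rfl] at happ
  rw [← happ, ← hB, ContinuousLinearMap.inverse_equiv]
  exact (B.symm_apply_apply _).symm

theorem RegularConnection.smoothOn_hCurvature {U : Set (TM E M)} (hU : IsOpen U)
    (hUs : U ⊆ slit E M) {X Y Z : PiField E M} (hX : X.SmoothOn U) (hY : Y.SmoothOn U)
    (hZ : Z.SmoothOn U) : (nabla.hCurvature X Y Z).SmoothOn U := by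
  have hbX := nabla.smoothOn_beta hU hUs hX
  have hbY := nabla.smoothOn_beta hU hUs hY
  have : CompleteSpace E := FiniteDimensional.complete ℝ E
  -- The bracket costs one derivative, which is harmless since `∞ + 1 = ∞`.
  have : IsManifold 𝓘(ℝ, E).tangent (∞ + 1) (TM E M) :=
    inferInstanceAs (IsManifold 𝓘(ℝ, E).tangent ∞ (TM E M))
  have : IsManifold 𝓘(ℝ, E).tangent (minSmoothness ℝ 2) (TM E M) :=
    .of_le (n := ∞) (by simpa using two_le_infty)
  have hbr : VField.SmoothOn (VectorField.mlieBracket 𝓘(ℝ, E).tangent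
      (fun u ↦ nabla.beta u (X u)) (fun u ↦ nabla.beta u (Y u))) U := fun u hu ↦
    (ContMDiffAt.mlieBracket_vectorField (m := ⊤) (n := ⊤)
      (hbX.contMDiffAt (hU.mem_nhds hu)) (hbY.contMDiffAt (hU.mem_nhds hu))
      (by simp)).contMDiffWithinAt
  have h1 := nabla.smoothOn_D hU hUs (nabla.smoothOn_D hU hUs hZ hbY) hbX
  have h2 := nabla.smoothOn_D hU hUs (nabla.smoothOn_D hU hUs hZ hbX) hbY
  have h3 := nabla.smoothOn_D hU hUs hZ hbr
  exact ((ContMDiffOn.neg_section h1).add_section h2).add_section h3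

end

/-! ### Smoothness of the curvature function of an h-isotropic structure -/

theorem trivialization_snd_smul_sub {B F : Type*} [TopologicalSpace B]
    [NormedAddCommGroup F] [NormedSpace ℝ F]
    {V : B → Type*} [∀ b, AddCommGroup (V b)] [∀ b, Module ℝ (V b)]
    [∀ b, TopologicalSpace (V b)] [TopologicalSpace (TotalSpace F V)] [FiberBundle F V]
    [VectorBundle ℝ F V] (e : Trivialization F (TotalSpace.proj : TotalSpace F V → B))
    [MemTrivializationAtlas e] {b : B} (hb : b ∈ e.baseSet) (c c₁ c₂ : ℝ) (v₁ v₂ : V b) :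
    (e ⟨b, c • (c₁ • v₁ - c₂ • v₂)⟩).2 = c • (c₁ • (e ⟨b, v₁⟩).2 - c₂ • (e ⟨b, v₂⟩).2) := by
  set A := e.continuousLinearEquivAt ℝ b hb
  have h : A (c • (c₁ • v₁ - c₂ • v₂)) = c • (c₁ • A v₁ - c₂ • A v₂) := by
    simp only [map_smul, map_sub]
  exact h

variable {F : FinslerStructure E M} {nabla : RegularConnection E M} {k : TM E M → ℝ}

theorem hasHCurvature_zero_iff :
    HasHCurvature F nabla (fun _ ↦ 0) ↔ TensorEq nabla.hCurvature (fun _ _ _ _ ↦ 0) := by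
  simp only [HasHCurvature, TensorEq, zero_smul]

variable [FiniteDimensional ℝ E]

/-- Provides `φ b * ψ a - φ a * ψ b ≠ 0`, the nonvanishing determinant needed to solve for `k`; `b`
exists because the line through `a` is not all of `E`. -/
theorem exists_separating_functionals (hn : 2 ≤ Module.finrank ℝ E) {a : E} (ha : a ≠ 0) :
    ∃ (b : E) (φ ψ : E →L[ℝ] ℝ), φ a = 0 ∧ φ b ≠ 0 ∧ ψ a ≠ 0 := by
  have hne : (ℝ ∙ a) ≠ ⊤ := by
    intro h
    have h1 := finrank_span_singleton (K := ℝ) ha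
    rw [h, finrank_top] at h1
    omega
  obtain ⟨b, -, hb⟩ := SetLike.exists_of_lt (lt_top_iff_ne_top.2 hne)
  obtain ⟨f, hfb, hf⟩ := Submodule.exists_le_ker_of_notMem hb
  obtain ⟨ψ, hψ⟩ := SeparatingDual.exists_ne_zero (R := ℝ) ha
  exact ⟨b, LinearMap.toContinuousLinearMap f, ψ, hf (Submodule.mem_span_singleton_self a),
    hfb, hψ⟩

/-- Cramer's rule: `k` is the determinant of `(R(η, Y)η, η)` divided by `L²` times that of `(Y, η)`,
both formed with `φ` and `ψ`. Only `L²`, not `g(Y, η)`, enters the quotient, so smoothness of `g` is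
not needed. -/
theorem HasHCurvature.isScalarFunction (h : HasHCurvature F nabla k)
    (hn : 2 ≤ Module.finrank ℝ E) : IsScalarFunction k := by
  intro u hu
  refine ContMDiffAt.contMDiffWithinAt ?_
  set e := trivializationAt E (PB E M) u
  have hmem : u ∈ e.baseSet := FiberBundle.mem_baseSet_trivializationAt' u
  -- Here `a` is the coordinate vector of `η(u)`, nonzero because `u` is.
  obtain ⟨b, φ, ψ, hφa, hφb, hψa⟩ := exists_separating_functionals hn
    (mt (trivialization_snd_eq_zero_iff e hmem (eta E M u)).1 hu)
  obtain ⟨y, hy⟩ : ∃ y : PB E M u, (e ⟨u, y⟩).2 = b :=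
    (e.continuousLinearEquivAt ℝ u hmem).surjective b
  obtain ⟨U, hU, hUs, huU, hext⟩ := exists_isOpen_smoothOn_extend hu
  obtain ⟨Y, hY, hYu⟩ : ∃ Y : PiField E M, Y.SmoothOn U ∧ Y u = y :=
    ⟨_, hext y, FiberBundle.extend_apply_self E y⟩
  have hη := smoothOn_eta U
  have hR := nabla.smoothOn_hCurvature hU hUs hη hY hη
  have hcoord : ∀ {X : PiField E M}, X.SmoothOn U → ∀ f : E →L[ℝ] ℝ,
      ContMDiffAt 𝓘(ℝ, E).tangent 𝓘(ℝ, ℝ) ∞ (fun w ↦ f (e ⟨w, X w⟩).2) u := fun hX f ↦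
    f.contMDiff.contMDiffAt.comp u ((contMDiffAt_section u).1 (hX.contMDiffAt (hU.mem_nhds huU)))
  have hnum := ((hcoord hR φ).mul (hcoord hη ψ)).sub ((hcoord hη φ).mul (hcoord hR ψ))
  have hdet := ((hcoord hY φ).mul (hcoord hη ψ)).sub ((hcoord hη φ).mul (hcoord hY ψ))
  have hL : ContMDiffAt 𝓘(ℝ, E).tangent 𝓘(ℝ, ℝ) ∞ (fun w ↦ F.L w ^ 2) u :=
    (F.smooth.contMDiffAt (isOpen_slit.mem_nhds hu)).pow 2
  have hdetu : φ (e ⟨u, Y u⟩).2 * ψ (e ⟨u, eta E M u⟩).2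
      - φ (e ⟨u, eta E M u⟩).2 * ψ (e ⟨u, Y u⟩).2 ≠ 0 := by
    rw [hYu, hy, hφa, zero_mul, sub_zero]
    exact mul_ne_zero hφb hψa
  refine (hnum.div₀ (hL.mul hdet) (mul_ne_zero (pow_ne_zero 2 (F.pos u hu).ne')
    hdetu)).congr_of_eventuallyEq ?_
  filter_upwards [hU.mem_nhds huU, e.open_baseSet.mem_nhds hmem,
    hdet.continuousAt.eventually_ne hdetu] with w hw hwe hwd
  have hLw : F.L w ^ 2 ≠ 0 := pow_ne_zero 2 (F.pos w (hUs hw)).ne'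
  refine (eq_div_iff (mul_ne_zero hLw hwd)).2 ?_
  have hcurv : nabla.hCurvature (eta E M) Y (eta E M) w
      = k w • (F.L w ^ 2 • Y w - F.g w (Y w) (eta E M w) • eta E M w) := by
    rw [← F.g_eta_eta]
    exact h U hU hUs _ _ _ hη hY hη w hw
  have hlin : (e ⟨w, nabla.hCurvature (eta E M) Y (eta E M) w⟩).2
      = k w • (F.L w ^ 2 • (e ⟨w, Y w⟩).2
        - F.g w (Y w) (eta E M w) • (e ⟨w, eta E M w⟩).2) := by
    rw [hcurv]
    exact trivialization_snd_smul_sub e hwe _ _ _ _ _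
  -- The `g(Y, η) η` contributions to the two products cancel, since the determinant of `(η, η)` is
  -- zero.
  simp only [Pi.mul_apply, hlin, map_smul, map_sub, smul_eq_mul]
  ring

/-- A structure is concircularly flat if and only if it is h-isotropic. -/
theorem isConcircularlyFlat_iff_isHIsotropic (hn : 2 ≤ Module.finrank ℝ E) :
    IsConcircularlyFlat F nabla ↔ IsHIsotropic F nabla := by
  rw [isConcircularlyFlat_iff_hasHCurvature]
  refine ⟨fun h ↦ ⟨_, h.isScalarFunction hn, h⟩, fun ⟨k, _, h⟩ ↦ ?_⟩
  exact h.congr fun u hu ↦ h.eq_scalarCurvature_div hn hu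

end

end PullbackFinsler

open PullbackFinsler

theorem proposition2p4 {E : Type*} [NormedAddCommGroup E] [NormedSpace ℝ E]
    [FiniteDimensional ℝ E]
    {M : Type*} [TopologicalSpace M] [ChartedSpace E M] [IsManifold 𝓘(ℝ, E) ∞ M]
    (n : ℕ) (hn : Module.finrank ℝ E = n) (hn3 : 3 ≤ n)
    (F : PullbackFinsler.FinslerStructure E M) (nabla : PullbackFinsler.RegularConnection E M)
    (hnabla : PullbackFinsler.IsCartanConnection F nabla) :
    (PullbackFinsler.IsConcircularlyFlat F nabla ↔ PullbackFinsler.IsHIsotropic F nabla) ∧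
    (∀ k : PullbackFinsler.TM E M → ℝ, PullbackFinsler.HasHCurvature F nabla k →
      ∀ u ∈ PullbackFinsler.slit E M,
        k u = PullbackFinsler.scalarCurvature F nabla u / ((n : ℝ) * ((n : ℝ) - 1))) ∧
    ((PullbackFinsler.IsConcircularlyFlat F nabla ∧
        ¬ PullbackFinsler.TensorEq nabla.hCurvature (fun _ _ _ _ ↦ 0)) ↔
      ∃ k : PullbackFinsler.TM E M → ℝ, PullbackFinsler.IsScalarFunction k ∧
        (∃ u ∈ PullbackFinsler.slit E M, k u ≠ 0) ∧
        PullbackFinsler.HasHCurvature F nabla k) := by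
  subst hn
  have hn2 : 2 ≤ Module.finrank ℝ E := by omega
  refine ⟨isConcircularlyFlat_iff_isHIsotropic hn2,
    fun k h u hu ↦ h.eq_scalarCurvature_div hn2 hu, ?_, ?_⟩
  · rintro ⟨hflat, hR⟩
    obtain ⟨k, hk, h⟩ := (isConcircularlyFlat_iff_isHIsotropic hn2).1 hflat
    refine ⟨k, hk, ?_, h⟩
    -- A factor vanishing at all nonzero vectors would force `R = 0`.
    by_contra! hzero
    exact hR (hasHCurvature_zero_iff.1 (h.congr hzero))
  · rintro ⟨k, hk, ⟨u, hu, hku⟩, h⟩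
    refine ⟨(isConcircularlyFlat_iff_isHIsotropic hn2).2 ⟨k, hk, h⟩, fun h0 ↦ hku ?_⟩
    -- If `R = 0`, both `k` and the zero function are factors, so both equal `r / (n (n - 1))` at
    -- `u`.
    rw [h.eq_scalarCurvature_div hn2 hu,
      ← (hasHCurvature_zero_iff (F := F).2 h0).eq_scalarCurvature_div hn2 hu]
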